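/- For a positive integer $n$, let $\|n\|$ be the least number of ones needed to write $n$ using additions, multiplications and parentheses, and let $\delta(n)=\|n\|-3\log_3 n$. Call $n$ stable if $\|3^k n\|=3k+\|n\|$ for every $k\ge 0$. Let $\mathscr{D}_{\mathrm{st}}=\{\delta(n): n \text{ stable}\}$ and, for a congruence class $u$ modulo $3$, let $\mathscr{D}_{\mathrm{st}}^u=\mathscr{D}_{\mathrm{st}}\cap\{\delta(n): n>1,\ \|n\|\equiv u \pmod 3\}$. Closures are taken in $\mathbb{R}$. For a well-ordered set $S\subseteq\mathbb{R}$ and an ordinal $\alpha>0$, $S(\alpha)$ denotes the $\alpha$-th element of $S$, counted from $1$; that is, $S(\alpha)$ is the $x\in S$ such that $\{s\in S: s<x\}$ has order type $\beta$, where $1+\beta=\alpha$. For an ordinal $\alpha>0$ with Cantor normal form $\omega^{\alpha_0}a_0+\dots+\omega^{\alpha_r}a_r$ (where $\alpha_0>\dots>\alpha_r$ and the $a_i$ are positive integers), put $\operatorname{ord}\alpha=\alpha_r$. Theorem. Let $q$ be a stable number, let $k\ge 0$ be an integer, and let $\eta=\delta(q)+k$. Then the sets $\overline{\mathscr{D}_{\mathrm{st}}}$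 and $\overline{\mathscr{D}_{\mathrm{st}}^{\|q\|+k}}$ are well-ordered, and $\eta\in\overline{\mathscr{D}_{\mathrm{st}}^{\|q\|+k}}$ (hence also $\eta\in\overline{\mathscr{D}_{\mathrm{st}}}$). Moreover, if we write $\eta=\overline{\mathscr{D}_{\mathrm{st}}}(\alpha)$, then $\operatorname{ord}\alpha=k$. Similarly, if we write $\eta=\overline{\mathscr{D}_{\mathrm{st}}^{\|q\|+k}}(\beta)$, then $\operatorname{ord}\beta=k$. -/

import Mathlib

/-- Formal expressions built from the number one by additions and multiplications. -/
inductive OneExpr : Type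
  | one : OneExpr
  | add : OneExpr → OneExpr → OneExpr
  | mul : OneExpr → OneExpr → OneExpr

/-- The natural number that an expression evaluates to. -/
def OneExpr.val : OneExpr → ℕ
  | .one => 1
  | .add a b => a.val + b.val
  | .mul a b => a.val * b.val

/-- The number of ones occurring in an expression. -/
def OneExpr.ones : OneExpr → ℕ
  | .one => 1
  | .add a b => a.ones + b.ones
  | .mul a b => a.ones + b.ones

/-- The integer complexity of `n`: the least number of ones in an expression for `n`.
It is meaningful for `0 < n`; no expression has value `0`. -/
noncomputable def cpx (n : ℕ) : ℕ :=
  sInf {m : ℕ | ∃ e : OneExpr, e.val = n ∧ e.ones = m}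

/-- The defect of `n`, the complexity of `n` minus three times the base three logarithm. -/
noncomputable def defect (n : ℕ) : ℝ :=
  (cpx n : ℝ) - 3 * Real.logb 3 (n : ℝ)

/-- A positive integer `n` is stable if the complexity of `3 ^ k * n` is `3 * k` plus the
complexity of `n`, for every `k`. -/
def IsStable (n : ℕ) : Prop :=
  0 < n ∧ ∀ k : ℕ, cpx (3 ^ k * n) = 3 * k + cpx n

/-- The set of stable defects. -/
def stableDefects : Set ℝ :=
  {x : ℝ | ∃ n : ℕ, IsStable n ∧ defect n = x}

/-- The set of defects of the numbers `n > 1` whose complexity lies in the class `u`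
modulo three. -/
def classDefects (u : ZMod 3) : Set ℝ :=
  {x : ℝ | ∃ n : ℕ, 1 < n ∧ (cpx n : ZMod 3) = u ∧ defect n = x}

/-- The set of stable defects in the class `u` modulo three. -/
def classStableDefects (u : ZMod 3) : Set ℝ :=
  classDefects u ∩ stableDefects

/-- For a well-ordered set `S` of reals, `x` is the element `S[α]` with the 0-based index `α`:
the elements of `S` below `x` have order type `α`. -/
def IsElemZeroIndexed (S : Set ℝ) (α : Ordinal.{0}) (x : ℝ) : Prop :=
  x ∈ S ∧ Nonempty (Set.Iio α ≃o {s : ℝ // s ∈ S ∧ s < x})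

/-- For a well-ordered set `S` of reals, `x` is the element `S(α)` with the 1-based index `α`:
`S(α) = S[-1 + α]`, where `-1 + α` is the ordinal `β` with `1 + β = α`. -/
def IsElemOneIndexed (S : Set ℝ) (α : Ordinal.{0}) (x : ℝ) : Prop :=
  ∃ β : Ordinal.{0}, 1 + β = α ∧ IsElemZeroIndexed S β x

/-- The last (smallest) exponent in the Cantor normal form of `α`, for `α ≠ 0`. The value
at `0` is a default. -/
noncomputable def lastCNFExponent (α : Ordinal.{0}) : Ordinal.{0} :=
  ((Ordinal.CNF Ordinal.omega0 α).map Prod.fst).getLastD 0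

/-! The proof rests on a compactness statement, `convergesUpToThreePow_of_defect_le`: along an
ultrafilter, numbers n of bounded defect approach a·3^t from above for one fixed a, with ‖n‖ = c +
3t and c ≥ ‖a‖. Their defects then converge from below to δ(a) + (c − ‖a‖), and are eventually
constant if c = ‖a‖.

Convergence from below makes the stable defects well-ordered. The dichotomy shows that a limit point
of values δ(p) + j with j ≥ r again has this form with j ≥ r + 1. Hence an element of the closure
whose position is divisible by ω^r is some δ(p) + j with j ≥ r. Since a stable δ(q) is never δ(p) +
j with j > 0 (`IsStable.shift_eq_zero`), ω^(k+1) does not divide the position of δ(q) + k.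

Conversely, for large m the number q·3^m + 1 is stable of complexity ‖q‖ + 3m + 1
(`IsStable.eventually_isStable`, by compactness again), and its defect tends to δ(q) + 1 strictly
from below. Iterating this within one class modulo 3 shows that ω^k divides the position. -/

/-! ### Basic properties of integer complexity -/

theorem OneExpr.val_pos (e : OneExpr) : 0 < e.val := by
  induction e with
  | one => exact Nat.one_pos
  | add a b iha ihb => exact Nat.add_pos_left iha _
  | mul a b iha ihb => exact Nat.mul_pos iha ihb

theorem OneExpr.ones_pos (e : OneExpr) : 0 < e.ones := by
  induction e with
  | one => exact Nat.one_pos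
  | add a b iha ihb => exact Nat.add_pos_left iha _
  | mul a b iha ihb => exact Nat.add_pos_left iha _

theorem OneExpr.exists_val_eq {n : ℕ} (hn : 0 < n) : ∃ e : OneExpr, e.val = n := by
  induction n, hn using Nat.le_induction with
  | base => exact ⟨.one, rfl⟩
  | succ n _ ih =>
    obtain ⟨e, he⟩ := ih
    exact ⟨.add e .one, by simp [OneExpr.val, he]⟩

theorem cpx_val_le (e : OneExpr) : cpx e.val ≤ e.ones :=
  Nat.sInf_le ⟨e, rfl, rfl⟩

theorem exists_ones_eq_cpx {n : ℕ} (hn : 0 < n) :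
    ∃ e : OneExpr, e.val = n ∧ e.ones = cpx n := by
  obtain ⟨e, he⟩ := OneExpr.exists_val_eq hn
  exact Nat.sInf_mem (s := {m : ℕ | ∃ e : OneExpr, e.val = n ∧ e.ones = m}) ⟨e.ones, e, he, rfl⟩

theorem cpx_pos {n : ℕ} (hn : 0 < n) : 0 < cpx n := by
  obtain ⟨e, -, h⟩ := exists_ones_eq_cpx hn
  exact h ▸ e.ones_pos

theorem cpx_add_le {a b : ℕ} (ha : 0 < a) (hb : 0 < b) : cpx (a + b) ≤ cpx a + cpx b := by
  obtain ⟨e, rfl, he⟩ := exists_ones_eq_cpx ha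
  obtain ⟨f, rfl, hf⟩ := exists_ones_eq_cpx hb
  rw [← he, ← hf]
  exact cpx_val_le (.add e f)

theorem cpx_mul_le {a b : ℕ} (ha : 0 < a) (hb : 0 < b) : cpx (a * b) ≤ cpx a + cpx b := by
  obtain ⟨e, rfl, he⟩ := exists_ones_eq_cpx ha
  obtain ⟨f, rfl, hf⟩ := exists_ones_eq_cpx hb
  rw [← he, ← hf]
  exact cpx_val_le (.mul e f)

theorem cpx_one : cpx 1 = 1 :=
  le_antisymm (cpx_val_le .one) (cpx_pos one_pos)

theorem cpx_three_pow_mul_le (t : ℕ) {n : ℕ} (hn : 0 < n) :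
    cpx (3 ^ t * n) ≤ 3 * t + cpx n := by
  induction t with
  | zero => simp
  | succ t ih =>
    have h3 : cpx 3 ≤ 3 := cpx_val_le (.add (.add .one .one) .one)
    have := cpx_mul_le (a := 3) (b := 3 ^ t * n) (by norm_num) (by positivity)
    rw [show 3 ^ (t + 1) * n = 3 * (3 ^ t * n) by ring]
    omega

/-- Every number is one, or an efficient sum, or an efficient product, of smaller numbers. -/
theorem cpx_decomposition {n : ℕ} (hn : 0 < n) :
    n = 1 ∨
    (∃ a b, 0 < b ∧ b ≤ a ∧ n = a + b ∧ cpx n = cpx a + cpx b) ∨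
    (∃ a b, 0 < a ∧ a < n ∧ 0 < b ∧ b < n ∧ n = a * b ∧ cpx n = cpx a + cpx b) := by
  obtain ⟨e, rfl, he⟩ := exists_ones_eq_cpx hn
  cases e with
  | one => exact Or.inl rfl
  | add e f =>
    refine Or.inr (Or.inl ?_)
    have h1 := cpx_val_le e
    have h2 := cpx_val_le f
    have h3 := cpx_add_le e.val_pos f.val_pos
    simp only [OneExpr.val, OneExpr.ones] at *
    rcases le_total f.val e.val with h | h
    · exact ⟨e.val, f.val, f.val_pos, h, rfl, by omega⟩
    · exact ⟨f.val, e.val, e.val_pos, h, add_comm _ _, by omega⟩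
  | mul e f =>
    refine Or.inr (Or.inr ?_)
    have h1 := cpx_val_le e
    have h2 := cpx_val_le f
    have h3 := cpx_mul_le e.val_pos f.val_pos
    have pe := e.val_pos
    have pf := f.val_pos
    simp only [OneExpr.val, OneExpr.ones] at *
    have h4 : cpx (e.val * f.val) = cpx e.val + cpx f.val := by omega
    have c1 := cpx_pos pe
    have c2 := cpx_pos pf
    refine ⟨e.val, f.val, pe, ?_, pf, ?_, rfl, h4⟩
    · refine lt_of_le_of_ne (Nat.le_mul_of_pos_right _ pf) fun h => ?_
      rw [← h] at h4
      omega
    · refine lt_of_le_of_ne (Nat.le_mul_of_pos_left _ pe) fun h => ?_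
      rw [← h] at h4
      omega

/-! ### The cubic lower bound for complexity and its gap -/

/-- The constant 8/9 = 2³/3² is attained at 1 + 1. For b = 1 and a ≥ 3 one uses a + 1 ≤ 4a/3; for b
≥ 2 one uses a + b ≤ 2a and y ≥ 2. The excluded sum 2 + 1 is a power of three. -/
theorem nine_mul_add_cube_le {a b x y : ℕ} (hb : 0 < b) (hba : b ≤ a) (hx : a ^ 3 ≤ 3 ^ x)
    (hy : b ^ 3 ≤ 3 ^ y) (hpos : 0 < x) (hpos' : 0 < y) (hne : a + b ≠ 3) :
    9 * (a + b) ^ 3 ≤ 8 * 3 ^ (x + y) := by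
  have key : ∀ {d : ℕ}, d ≤ y → 3 ^ x * 3 ^ d ≤ 3 ^ (x + y) := fun hd => by
    rw [← pow_add]
    exact Nat.pow_le_pow_right (by norm_num) (by omega)
  rcases Nat.lt_or_ge b 2 with h | h
  · obtain rfl : b = 1 := by omega
    rcases Nat.lt_or_ge a 3 with h' | h'
    · obtain rfl : a = 1 := by omega
      have : 3 ^ 2 ≤ 3 ^ (x + y) := Nat.pow_le_pow_right (by norm_num) (by omega)
      omega
    · have h1 : (3 * (a + 1)) ^ 3 ≤ (4 * a) ^ 3 := Nat.pow_le_pow_left (by omega) 3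
      have h2 := key (d := 1) hpos'
      rw [mul_pow, mul_pow] at h1
      omega
  · have h1 : (a + b) ^ 3 ≤ (2 * a) ^ 3 := Nat.pow_le_pow_left (by omega) 3
    have h3 : 2 ^ 3 ≤ b ^ 3 := Nat.pow_le_pow_left h 3
    have h4 : 2 ≤ y := by
      by_contra hlt
      obtain rfl : y = 1 := by omega
      omega
    have h2 := key h4
    rw [mul_pow] at h1
    omega

/-- Both bounds go through one induction: in a product that is not a power of three some factor is
not one either, and that factor supplies the 8/9. -/
theorem cube_le_three_pow_cpx_and_gap {n : ℕ} (hn : 0 < n) :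
    n ^ 3 ≤ 3 ^ cpx n ∧ ((∀ t, n ≠ 3 ^ t) → 9 * n ^ 3 ≤ 8 * 3 ^ cpx n) := by
  induction n using Nat.strong_induction_on with
  | _ n ih =>
    rcases cpx_decomposition hn with rfl | ⟨a, b, hb, hba, rfl, h⟩ | ⟨a, b, ha, han, hb, hbn, h, h'⟩
    · exact ⟨by simp [cpx_one], fun h => absurd rfl (h 0)⟩
    · have ha : 0 < a := hb.trans_le hba
      have i1 := (ih a (by omega) ha).1
      have i2 := (ih b (by omega) hb).1
      have gap := nine_mul_add_cube_le hb hba i1 i2 (cpx_pos ha) (cpx_pos hb)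
      rw [h]
      by_cases h3 : a + b = 3
      · refine ⟨?_, fun hp => absurd h3 (hp 1)⟩
        obtain ⟨rfl, rfl⟩ : a = 2 ∧ b = 1 := by omega
        rw [cpx_one]
        have : 2 ≤ cpx 2 := by
          by_contra hlt
          have : cpx 2 = 1 := by have := cpx_pos (n := 2) (by norm_num); omega
          rw [this] at i1
          omega
        exact (Nat.pow_le_pow_right (by norm_num) (by omega : 3 ≤ cpx 2 + 1) : 3 ^ 3 ≤ _)
      · have := gap h3
        exact ⟨by omega, fun _ => this⟩
    · obtain ⟨i1, j1⟩ := ih a han ha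
      obtain ⟨i2, j2⟩ := ih b hbn hb
      rw [h', h, mul_pow, pow_add]
      refine ⟨Nat.mul_le_mul i1 i2, fun hp => ?_⟩
      by_cases h1 : ∃ s, a = 3 ^ s
      · by_cases h2 : ∃ t, b = 3 ^ t
        · obtain ⟨s, rfl⟩ := h1
          obtain ⟨t, rfl⟩ := h2
          exact absurd (pow_add 3 s t).symm (hp _)
        · have := Nat.mul_le_mul i1 (j2 (by simpa using h2))
          linarith
      · have := Nat.mul_le_mul (j1 (by simpa using h1)) i2
        linarith

theorem cube_le_three_pow_cpx {n : ℕ} (hn : 0 < n) : n ^ 3 ≤ 3 ^ cpx n :=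
  (cube_le_three_pow_cpx_and_gap hn).1

theorem le_three_pow_cpx {n : ℕ} (hn : 0 < n) : n ≤ 3 ^ cpx n :=
  (Nat.le_self_pow (by norm_num) n).trans (cube_le_three_pow_cpx hn)

theorem cpx_three_pow {t : ℕ} (ht : t ≠ 0) : cpx (3 ^ t) = 3 * t := by
  refine le_antisymm ?_ ?_
  · obtain ⟨t, rfl⟩ := Nat.exists_eq_succ_of_ne_zero ht
    have h3 : cpx 3 ≤ 3 := cpx_val_le (.add (.add .one .one) .one)
    have := cpx_three_pow_mul_le t (n := 3) (by norm_num)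
    rw [Nat.succ_eq_add_one, pow_succ]
    omega
  · have := cube_le_three_pow_cpx (n := 3 ^ t) (by positivity)
    rw [← pow_mul] at this
    have := (Nat.pow_le_pow_iff_right (by norm_num)).1 this
    omega

/-- Removing an efficient power of three leaves one, three, an efficient sum, or an efficient
product of two numbers that are not powers of three. -/
theorem cpx_decomposition_three_pow {n : ℕ} (hn : 0 < n) :
    ∃ t m, 0 < m ∧ n = 3 ^ t * m ∧ cpx n = 3 * t + cpx m ∧
      ((m = 1 ∨ m = 3) ∨
      (∃ a b, 0 < b ∧ b ≤ a ∧ m = a + b ∧ cpx m = cpx a + cpx b) ∨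
      (∃ a b, 0 < a ∧ 0 < b ∧ (∀ s, a ≠ 3 ^ s) ∧ (∀ s, b ≠ 3 ^ s) ∧ m = a * b ∧
        cpx m = cpx a + cpx b)) := by
  induction n using Nat.strong_induction_on with
  | _ n ih =>
    have step : ∀ a b, 0 < b → b < n → a < n → n = a * b → cpx n = cpx a + cpx b →
        (∃ s, a = 3 ^ s) → ∃ t m, 0 < m ∧ n = 3 ^ t * m ∧ cpx n = 3 * t + cpx m ∧
      ((m = 1 ∨ m = 3) ∨
      (∃ a b, 0 < b ∧ b ≤ a ∧ m = a + b ∧ cpx m = cpx a + cpx b) ∨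
      (∃ a b, 0 < a ∧ 0 < b ∧ (∀ s, a ≠ 3 ^ s) ∧ (∀ s, b ≠ 3 ^ s) ∧ m = a * b ∧
        cpx m = cpx a + cpx b)) := by
      rintro a b hb hbn han h h' ⟨s, rfl⟩
      obtain ⟨t, m, hm, h1, h2, h3⟩ := ih b hbn hb
      have hs : s ≠ 0 := by
        rintro rfl
        simp at h
        omega
      refine ⟨s + t, m, hm, by rw [h, h1, pow_add, mul_assoc], ?_, h3⟩
      rw [h', h2, cpx_three_pow hs]
      ring
    rcases cpx_decomposition hn with h | h | ⟨a, b, ha, han, hb, hbn, h, h'⟩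
    · exact ⟨0, n, hn, by simp, by simp, Or.inl (Or.inl h)⟩
    · exact ⟨0, n, hn, by simp, by simp, Or.inr (Or.inl h)⟩
    · by_cases h1 : ∃ s, a = 3 ^ s
      · exact step a b hb hbn han h h' h1
      by_cases h2 : ∃ s, b = 3 ^ s
      · exact step b a ha han hbn (by rw [h, mul_comm]) (by omega) h2
      exact ⟨0, n, hn, by simp, by simp, Or.inr (Or.inr ⟨a, b, ha, hb, by simpa using h1,
        by simpa using h2, h, h'⟩)⟩

theorem Ultrafilter.eventually_eq_of_eventually_le {ι : Type*} {l : Ultrafilter ι} {f : ι → ℕ}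
    {N : ℕ} (h : ∀ᶠ i in l, f i ≤ N) : ∃ c, ∀ᶠ i in l, f i = c := by
  induction N with
  | zero => exact ⟨0, h.mono fun i hi => Nat.le_zero.1 hi⟩
  | succ N ih =>
    rcases Ultrafilter.eventually_or.1
      (h.mono fun i hi => (Nat.lt_or_eq_of_le hi).imp_left Nat.lt_succ_iff.1) with h | h
    · exact ih h
    · exact ⟨_, h⟩

/-! ### Defects of products and sums -/

theorem logb_three_pow (n : ℕ) : Real.logb 3 ((3 : ℝ) ^ n) = n := by
  rw [Real.logb_pow, Real.logb_self_eq_one (by norm_num), mul_one]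

theorem three_mul_logb_natCast (n : ℕ) : 3 * Real.logb 3 (n : ℝ) = Real.logb 3 ((n : ℝ) ^ 3) := by
  rw [Real.logb_pow]
  norm_num

theorem defect_nonneg {n : ℕ} (hn : 0 < n) : 0 ≤ defect n := by
  have h : ((n : ℝ) ^ 3) ≤ 3 ^ cpx n := by exact_mod_cast cube_le_three_pow_cpx hn
  have := Real.logb_le_logb_of_le (b := 3) (by norm_num) (by positivity) h
  rw [logb_three_pow] at this
  rw [defect, three_mul_logb_natCast]
  linarith

theorem logb_nine_eighths_pos : 0 < Real.logb 3 (9 / 8) :=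
  Real.logb_pos (by norm_num) (by norm_num)

theorem logb_nine_eighths_le : Real.logb 3 (9 / 8) ≤ 1 / 2 := by
  have h : Real.logb 3 ((9 / 8 : ℝ) ^ 2) ≤ Real.logb 3 3 :=
    Real.logb_le_logb_of_le (by norm_num) (by norm_num) (by norm_num)
  rw [Real.logb_pow, Real.logb_self_eq_one (by norm_num)] at h
  push_cast at h
  linarith

/-- The gap between zero and the defects of the numbers that are not powers of three. -/
theorem logb_nine_eighths_le_defect {n : ℕ} (hn : 0 < n) (h : ∀ t, n ≠ 3 ^ t) :
    Real.logb 3 (9 / 8) ≤ defect n := by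
  have h : (9 : ℝ) * ((n : ℝ) ^ 3) ≤ 8 * 3 ^ cpx n := by
    exact_mod_cast (cube_le_three_pow_cpx_and_gap hn).2 h
  have hn' : (0 : ℝ) < n := by exact_mod_cast hn
  have := Real.logb_le_logb_of_le (b := 3) (x := 9 / 8 * (n : ℝ) ^ 3) (by norm_num) (by positivity)
    (by linarith : _ ≤ (3 : ℝ) ^ cpx n)
  rw [logb_three_pow, Real.logb_mul (by norm_num) (by positivity)] at this
  rw [defect, three_mul_logb_natCast]
  linarith

theorem defect_mul {a b : ℕ} (ha : 0 < a) (hb : 0 < b) (h : cpx (a * b) = cpx a + cpx b) :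
    defect (a * b) = defect a + defect b := by
  have ha' : (a : ℝ) ≠ 0 := by exact_mod_cast ha.ne'
  have hb' : (b : ℝ) ≠ 0 := by exact_mod_cast hb.ne'
  simp only [defect, h]
  push_cast
  rw [Real.logb_mul ha' hb']
  ring

/-- The defect of a number close to `a * 3 ^ t`. -/
theorem defect_eq_of_cpx_eq {n c t : ℕ} (hn : 0 < n) (h : cpx n = c + 3 * t) :
    defect n = c - 3 * Real.logb 3 ((n : ℝ) / 3 ^ t) := by
  have hn' : (n : ℝ) ≠ 0 := by exact_mod_cast hn.ne'
  rw [Real.logb_div hn' (by positivity), logb_three_pow, defect, h]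
  push_cast
  ring

theorem defect_three_pow_mul {t m : ℕ} (hm : 0 < m) (h : cpx (3 ^ t * m) = 3 * t + cpx m) :
    defect (3 ^ t * m) = defect m := by
  rw [defect_eq_of_cpx_eq (c := cpx m) (t := t) (by positivity) (by omega), defect]
  push_cast
  rw [mul_div_cancel_left₀ _ (by positivity)]

theorem defect_add {a b : ℕ} (ha : 0 < a) (h : cpx (a + b) = cpx a + cpx b) :
    defect (a + b) = defect a + cpx b - 3 * Real.logb 3 (1 + (b : ℝ) / a) := by
  have ha' : (0 : ℝ) < a := by exact_mod_cast ha
  have : (1 + (b : ℝ) / a) = (a + b) / a := by field_simp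
  rw [this, Real.logb_div (by positivity) (by positivity), defect, defect, h]
  push_cast
  ring

/-! ### Compactness of families of bounded defect -/

/-- Along the ultrafilter `l`, the numbers `n i` approach `a * 3 ^ t i` from above, for a fixed
`a`, and the complexities are those of `a * 3 ^ t i` up to a nonnegative constant that is positive
unless equality holds. -/
def ConvergesUpToThreePow {ι : Type*} (l : Ultrafilter ι) (n : ι → ℕ) : Prop :=
  ∃ (a c : ℕ) (t : ι → ℕ), 0 < a ∧ cpx a ≤ c ∧ (∀ᶠ i in l, cpx (n i) = c + 3 * t i) ∧
    (∀ᶠ i in l, a * 3 ^ t i ≤ n i) ∧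
    Filter.Tendsto (fun i => (n i : ℝ) / 3 ^ t i) l (nhds (a : ℝ)) ∧
    (cpx a < c ∨ ∀ᶠ i in l, n i = a * 3 ^ t i)

namespace ConvergesUpToThreePow

variable {ι : Type*} {l : Ultrafilter ι}

theorem const {n : ι → ℕ} {m : ℕ} (hm : 0 < m) (h : ∀ᶠ i in l, n i = m) :
    ConvergesUpToThreePow l n := by
  refine ⟨m, cpx m, fun _ => 0, hm, le_rfl, h.mono fun i hi => by simp [hi],
    h.mono fun i hi => by simp [hi], ?_, Or.inr (h.mono fun i hi => by simp [hi])⟩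
  exact tendsto_const_nhds.congr' (h.mono fun i hi => by simp [hi])

theorem congr {m n : ι → ℕ} (hm : ConvergesUpToThreePow l m) (h : ∀ᶠ i in l, m i = n i) :
    ConvergesUpToThreePow l n := by
  obtain ⟨a, c, t, ha, hc, h1, h2, h3, h4⟩ := hm
  refine ⟨a, c, t, ha, hc, ?_, ?_, h3.congr' (h.mono fun i hi => by simp only [hi]),
    h4.imp_right fun h4 => ?_⟩
  · filter_upwards [h, h1] with i e h1 using e ▸ h1
  · filter_upwards [h, h2] with i e h2 using e ▸ h2
  · filter_upwards [h, h4] with i e h2 using e ▸ h2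

theorem three_pow_mul {m : ι → ℕ} {s : ι → ℕ} (hm : ConvergesUpToThreePow l m)
    (h : ∀ᶠ i in l, cpx (3 ^ s i * m i) = 3 * s i + cpx (m i)) :
    ConvergesUpToThreePow l (fun i => 3 ^ s i * m i) := by
  obtain ⟨a, c, t, ha, hc, h1, h2, h3, h4⟩ := hm
  refine ⟨a, c, fun i => s i + t i, ha, hc, ?_, ?_, h3.congr fun i => ?_, h4.imp_right fun h4 => ?_⟩
  · filter_upwards [h, h1] with i h h1
    omega
  · filter_upwards [h2] with i h2
    calc a * 3 ^ (s i + t i) = 3 ^ s i * (a * 3 ^ t i) := by ring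
      _ ≤ _ := Nat.mul_le_mul_left _ h2
  · push_cast
    rw [pow_add, mul_div_mul_left _ _ (by positivity)]
  · filter_upwards [h4] with i h4
    rw [h4]
    ring

theorem mul {m n : ι → ℕ} (hm : ConvergesUpToThreePow l m) (hn : ConvergesUpToThreePow l n)
    (h : ∀ᶠ i in l, cpx (m i * n i) = cpx (m i) + cpx (n i)) :
    ConvergesUpToThreePow l (fun i => m i * n i) := by
  obtain ⟨a, c, t, ha, hc, h1, h2, h3, h4⟩ := hm
  obtain ⟨a', c', t', ha', hc', h1', h2', h3', h4'⟩ := hn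
  have hle := cpx_mul_le ha ha'
  refine ⟨a * a', c + c', fun i => t i + t' i, by positivity, by omega, ?_, ?_, ?_, ?_⟩
  · filter_upwards [h, h1, h1'] with i h h1 h1'
    omega
  · filter_upwards [h2, h2'] with i h2 h2'
    calc a * a' * 3 ^ (t i + t' i) = (a * 3 ^ t i) * (a' * 3 ^ t' i) := by ring
      _ ≤ _ := Nat.mul_le_mul h2 h2'
  · push_cast
    refine (h3.mul h3').congr fun i => ?_
    rw [pow_add, div_mul_div_comm]
  · rcases h4 with h4 | h4
    · exact Or.inl (by omega)
    rcases h4' with h4' | h4'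
    · exact Or.inl (by omega)
    refine Or.inr ?_
    filter_upwards [h4, h4'] with i h4 h4'
    rw [h4, h4']
    ring

/-- A fixed summand disappears from the limiting ratio but still costs ‖b‖ ≥ 1 ones. This is the
source of strict inequality between c and ‖a‖. -/
theorem add_const {m : ι → ℕ} {b : ℕ} (hm : ConvergesUpToThreePow l m) (hb : 0 < b)
    (hlim : Filter.Tendsto (fun i => (m i : ℝ)) l Filter.atTop)
    (h : ∀ᶠ i in l, cpx (m i + b) = cpx (m i) + cpx b) :
    ConvergesUpToThreePow l (fun i => m i + b) := by
  obtain ⟨a, c, t, ha, hc, h1, h2, h3, h4⟩ := hm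
  have hcb := cpx_pos hb
  have ha' : (0 : ℝ) < a := by exact_mod_cast ha
  refine ⟨a, c + cpx b, t, ha, by omega, ?_, ?_, ?_, Or.inl (by omega)⟩
  · filter_upwards [h, h1] with i h h1
    omega
  · filter_upwards [h2] with i h2 using h2.trans (Nat.le_add_right _ _)
  · have h5 : Filter.Tendsto (fun i => (b : ℝ) / m i) l (nhds 0) :=
      hlim.const_div_atTop _
    have h6 := h3.add (h3.mul h5)
    rw [mul_zero, add_zero] at h6
    refine h6.congr' ?_
    filter_upwards [hlim.eventually_gt_atTop 0] with i hi
    push_cast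
    field_simp

/-- The limit of the defects of a convergent family. -/
theorem tendsto_defect {n : ι → ℕ} (hn : ConvergesUpToThreePow l n) :
    ∃ p k : ℕ, 0 < p ∧ Filter.Tendsto (fun i => defect (n i)) l (nhds (defect p + k)) ∧
      (∀ᶠ i in l, defect (n i) ≤ defect p + k) ∧
      (0 < k ∨ ∀ᶠ i in l, defect (n i) = defect p + k) := by
  obtain ⟨a, c, t, ha, hc, h1, h2, h3, h4⟩ := hn
  have ha' : (0 : ℝ) < a := by exact_mod_cast ha
  have hlim : defect a + ((c - cpx a : ℕ) : ℝ) = c - 3 * Real.logb 3 a := by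
    rw [defect, Nat.cast_sub hc]
    ring
  have heq : ∀ᶠ i in l, defect (n i) = c - 3 * Real.logb 3 ((n i : ℝ) / 3 ^ t i) := by
    filter_upwards [h1, h2] with i h1 h2
    exact defect_eq_of_cpx_eq (lt_of_lt_of_le (by positivity) h2) h1
  refine ⟨a, c - cpx a, ha, ?_, ?_, ?_⟩
  · rw [hlim]
    exact (tendsto_const_nhds.sub
      ((h3.logb ha'.ne').const_mul 3)).congr' (heq.mono fun i hi => hi.symm)
  · filter_upwards [heq, h2] with i heq h2
    have h2 : (a : ℝ) * 3 ^ t i ≤ n i := by exact_mod_cast h2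
    have := Real.logb_le_logb_of_le (b := 3) (by norm_num) ha'
      ((le_div_iff₀ (by positivity)).2 h2)
    rw [heq, hlim]
    linarith
  · rcases h4 with h4 | h4
    · exact Or.inl (by omega)
    refine Or.inr ?_
    filter_upwards [heq, h4] with i heq h4
    rw [heq, hlim, h4]
    push_cast
    rw [mul_div_cancel_right₀ _ (by positivity)]

end ConvergesUpToThreePow

/-- The smaller summand has bounded complexity, so it is constant along `l`. Either the larger one
is constant too, or it tends to infinity and its defect drops below `s`, where `ih` applies. -/
theorem convergesUpToThreePow_add {ι : Type*} {l : Ultrafilter ι} {n a b : ι → ℕ} {s : ℝ}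
    (ih : ∀ m : ι → ℕ, (∀ᶠ i in l, 0 < m i ∧ defect (m i) < s) → ConvergesUpToThreePow l m)
    (h : ∀ᶠ i in l, 0 < b i ∧ b i ≤ a i ∧ n i = a i + b i ∧ cpx (n i) = cpx (a i) + cpx (b i) ∧
      defect (n i) < s + 1 / 2) : ConvergesUpToThreePow l n := by
  -- The 3 bounds the loss 3 log₃(1 + b/a), as b ≤ a.
  have hcb : ∀ᶠ i in l, b i ≤ 3 ^ ⌈s + 1 / 2 + 3⌉₊ := by
    filter_upwards [h] with i ⟨hb, hba, hn, hc, hd⟩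
    have ha : 0 < a i := hb.trans_le hba
    rw [hn] at hc hd
    rw [defect_add ha hc] at hd
    have h1 := defect_nonneg ha
    have ha' : (0 : ℝ) < a i := by exact_mod_cast ha
    have h2 : Real.logb 3 (1 + (b i : ℝ) / a i) ≤ 1 := by
      rw [Real.logb_le_iff_le_rpow (by norm_num) (by positivity)]
      have : (b i : ℝ) / a i ≤ 1 := (div_le_one ha').2 (by exact_mod_cast hba)
      norm_num
      linarith
    refine (le_three_pow_cpx hb).trans (Nat.pow_le_pow_right (by norm_num) ?_)
    have : (cpx (b i) : ℝ) ≤ ⌈s + 1 / 2 + 3⌉₊ := le_trans (by linarith) (Nat.le_ceil _)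
    exact_mod_cast this
  obtain ⟨b₀, hb₀⟩ := Ultrafilter.eventually_eq_of_eventually_le hcb
  have hb₀pos : 0 < b₀ := by
    obtain ⟨i, hi, hi'⟩ := (h.and hb₀).exists
    exact hi' ▸ hi.1
  have h' : ∀ᶠ i in l, b₀ ≤ a i ∧ n i = a i + b₀ ∧ cpx (a i + b₀) = cpx (a i) + cpx b₀ ∧
      defect (a i + b₀) < s + 1 / 2 := by
    filter_upwards [h, hb₀] with i ⟨_, h2, h3, h4, h5⟩ hi
    rw [hi] at h2 h3 h4
    rw [h3] at h4 h5
    exact ⟨h2, h3, h4, h5⟩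
  by_cases hA : ∃ A, ∀ᶠ i in l, a i ≤ A
  · obtain ⟨A, hA⟩ := hA
    obtain ⟨a₀, ha₀⟩ := Ultrafilter.eventually_eq_of_eventually_le hA
    refine ConvergesUpToThreePow.const (m := a₀ + b₀) (by omega) ?_
    filter_upwards [h', ha₀] with i hi ha
    rw [hi.2.1, ha]
  have hlim : Filter.Tendsto (fun i => (a i : ℝ)) l Filter.atTop := by
    refine tendsto_natCast_atTop_atTop.comp (Filter.tendsto_atTop.2 fun A => ?_)
    rcases l.em (fun i => a i ≤ A) with h | h
    · exact absurd ⟨A, h⟩ hA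
    · exact h.mono fun i hi => (not_le.1 hi).le
  have hlog : Filter.Tendsto (fun i => 3 * Real.logb 3 (1 + (b₀ : ℝ) / a i)) l (nhds 0) := by
    have h1 := ((hlim.const_div_atTop (b₀ : ℝ)).const_add 1).logb (b := 3) (by norm_num)
    simpa using h1.const_mul 3
  refine (ConvergesUpToThreePow.add_const (ih a ?_) hb₀pos hlim (h'.mono fun i hi => hi.2.2.1)).congr
    (h'.mono fun i hi => hi.2.1.symm)
  -- The logarithmic loss is below 1/2 while ‖b₀‖ ≥ 1, which absorbs the allowance of 1/2 in the
  -- hypothesis.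
  filter_upwards [h', hlog.eventually_lt_const (by norm_num : (0 : ℝ) < 1 / 2)]
    with i ⟨h1, h2, h3, h4⟩ h5
  have ha : 0 < a i := by omega
  have h6 : (1 : ℝ) ≤ cpx b₀ := by exact_mod_cast cpx_pos hb₀pos
  rw [defect_add ha h3] at h4
  exact ⟨ha, by linarith⟩

/-- Induction on the bound in steps of ε = log₃(9/8). After efficient powers of three are removed,
both factors of a product have defect at least ε, so each lies under the previous bound. Sums are
handled separately, using ε ≤ 1/2. -/
theorem convergesUpToThreePow_of_defect_lt_nsmul {ι : Type*} {l : Ultrafilter ι} (k : ℕ) :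
    ∀ n : ι → ℕ, (∀ᶠ i in l, 0 < n i ∧ defect (n i) < k * Real.logb 3 (9 / 8)) →
      ConvergesUpToThreePow l n := by
  induction k with
  | zero =>
    intro n hn
    obtain ⟨i, h1, h2⟩ := hn.exists
    have := defect_nonneg h1
    norm_num at h2
    linarith
  | succ k ih =>
    intro n hn
    have hε := logb_nine_eighths_le
    have hdec : ∀ i, ∃ t m a b : ℕ, 0 < n i →
        0 < m ∧ n i = 3 ^ t * m ∧ cpx (n i) = 3 * t + cpx m ∧
        ((m = 1 ∨ m = 3) ∨ (0 < b ∧ b ≤ a ∧ m = a + b ∧ cpx m = cpx a + cpx b) ∨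
        (0 < a ∧ 0 < b ∧ (∀ s, a ≠ 3 ^ s) ∧ (∀ s, b ≠ 3 ^ s) ∧ m = a * b ∧
          cpx m = cpx a + cpx b)) := by
      intro i
      by_cases hi : 0 < n i
      · obtain ⟨t, m, h1, h2, h3, h | ⟨a, b, h⟩ | ⟨a, b, h⟩⟩ := cpx_decomposition_three_pow hi
        · exact ⟨t, m, 0, 0, fun _ => ⟨h1, h2, h3, Or.inl h⟩⟩
        · exact ⟨t, m, a, b, fun _ => ⟨h1, h2, h3, Or.inr (Or.inl h)⟩⟩
        · exact ⟨t, m, a, b, fun _ => ⟨h1, h2, h3, Or.inr (Or.inr h)⟩⟩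
      · exact ⟨0, 0, 0, 0, fun h => absurd h hi⟩
    choose t m a b hdec using hdec
    have hm : ∀ᶠ i in l, 0 < m i ∧ n i = 3 ^ t i * m i ∧
        cpx (3 ^ t i * m i) = 3 * t i + cpx (m i) ∧
        defect (m i) < k * Real.logb 3 (9 / 8) + Real.logb 3 (9 / 8) := by
      filter_upwards [hn] with i ⟨h1, h2⟩
      obtain ⟨h3, h4, h5, -⟩ := hdec i h1
      rw [h4] at h5 h2
      rw [defect_three_pow_mul h3 h5] at h2
      push_cast at h2
      exact ⟨h3, h4, h5, by linarith⟩
    suffices ConvergesUpToThreePow l m from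
      (this.three_pow_mul (hm.mono fun i hi => hi.2.2.1)).congr (hm.mono fun i hi => hi.2.1.symm)
    have hcases := hn.mono fun i hi => (hdec i hi.1).2.2.2
    rcases Ultrafilter.eventually_or.1 hcases with h | hcases
    · rcases Ultrafilter.eventually_or.1 h with h | h
      · exact .const one_pos h
      · exact .const three_pos h
    rcases Ultrafilter.eventually_or.1 hcases with h | h
    · refine convergesUpToThreePow_add (a := a) (b := b) ih ?_
      filter_upwards [hm, h] with i ⟨_, _, _, hd⟩ ⟨h1, h2, h3, h4⟩
      exact ⟨h1, h2, h3, h4, by linarith⟩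
    · have hab : ∀ᶠ i in l, (0 < a i ∧ defect (a i) < k * Real.logb 3 (9 / 8)) ∧
          (0 < b i ∧ defect (b i) < k * Real.logb 3 (9 / 8)) ∧ m i = a i * b i ∧
          cpx (a i * b i) = cpx (a i) + cpx (b i) := by
        filter_upwards [hm, h] with i ⟨_, _, _, hd⟩ ⟨h1, h2, h3, h4, h5, h6⟩
        rw [h5] at h6 hd
        rw [defect_mul h1 h2 h6] at hd
        have h7 := logb_nine_eighths_le_defect h1 h3
        have h8 := logb_nine_eighths_le_defect h2 h4
        exact ⟨⟨h1, by linarith⟩, ⟨h2, by linarith⟩, h5, h6⟩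
      exact (ConvergesUpToThreePow.mul (ih a (hab.mono fun i hi => hi.1))
        (ih b (hab.mono fun i hi => hi.2.1)) (hab.mono fun i hi => hi.2.2.2)).congr
        (hab.mono fun i hi => hi.2.2.1.symm)

/-- Numbers of bounded defect converge along every ultrafilter. -/
theorem convergesUpToThreePow_of_defect_le {ι : Type*} {l : Ultrafilter ι} {n : ι → ℕ} {s : ℝ}
    (hn : ∀ᶠ i in l, 0 < n i) (hs : ∀ᶠ i in l, defect (n i) ≤ s) : ConvergesUpToThreePow l n := by
  obtain ⟨k, hk⟩ := exists_nat_gt (s / Real.logb 3 (9 / 8))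
  refine convergesUpToThreePow_of_defect_lt_nsmul k n ?_
  filter_upwards [hn, hs] with i h1 h2
  exact ⟨h1, h2.trans_lt ((div_lt_iff₀ logb_nine_eighths_pos).1 hk)⟩

/-! ### Limit points of shifted defects -/

/-- The numbers `defect p + k` with `p` positive and `k` at least `r`. -/
def shiftedDefects (r : ℕ) : Set ℝ :=
  {x : ℝ | ∃ p k : ℕ, 0 < p ∧ r ≤ k ∧ defect p + k = x}

theorem shiftedDefects_antitone {r s : ℕ} (h : r ≤ s) : shiftedDefects s ⊆ shiftedDefects r := by
  rintro x ⟨p, k, hp, hk, rfl⟩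
  exact ⟨p, k, hp, h.trans hk, rfl⟩

theorem stableDefects_subset_shiftedDefects : stableDefects ⊆ shiftedDefects 0 := by
  rintro x ⟨n, hn, rfl⟩
  exact ⟨n, 0, hn.1, le_rfl, by simp⟩

/-- Along an ultrafilter tending to `x` the shift is a constant k₀ ≥ r, and the defects converge to
some δ(a) + j. If j were 0 the values would eventually equal `x`, which has been removed. -/
theorem mem_shiftedDefects_succ_of_mem_closure {r : ℕ} {x : ℝ}
    (hx : x ∈ closure (shiftedDefects r \ {x})) : x ∈ shiftedDefects (r + 1) := by
  obtain ⟨l, hl, hlx⟩ := mem_closure_iff_ultrafilter.1 hx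
  have hex : ∀ y : ℝ, ∃ p k : ℕ, y ∈ shiftedDefects r → 0 < p ∧ r ≤ k ∧ defect p + k = y := by
    intro y
    by_cases hy : y ∈ shiftedDefects r
    · obtain ⟨p, k, h⟩ := hy
      exact ⟨p, k, fun _ => h⟩
    · exact ⟨0, 0, fun h => absurd h hy⟩
  choose p k hpk using hex
  have h1 : ∀ᶠ y in l, (0 < p y ∧ r ≤ k y ∧ defect (p y) + k y = y) ∧ y ≠ x := by
    filter_upwards [show ∀ᶠ y in l, y ∈ shiftedDefects r \ {x} from hl] with y hy
    exact ⟨hpk y hy.1, hy.2⟩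
  have hlt : ∀ᶠ y in l, y < x + 1 := hlx (Iio_mem_nhds (by linarith))
  obtain ⟨k₀, hk₀⟩ : ∃ c, ∀ᶠ y in l, k y = c := by
    refine Ultrafilter.eventually_eq_of_eventually_le (N := ⌈x + 1⌉₊) ?_
    filter_upwards [h1, hlt] with y ⟨⟨h1, h2, h3⟩, _⟩ h4
    have := defect_nonneg h1
    have : (k y : ℝ) ≤ ⌈x + 1⌉₊ := le_trans (by linarith) (Nat.le_ceil _)
    exact_mod_cast this
  have hconv : ConvergesUpToThreePow l p := by
    refine convergesUpToThreePow_of_defect_le (s := x + 1) (h1.mono fun y hy => hy.1.1) ?_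
    filter_upwards [h1, hlt] with y ⟨⟨h1, h2, h3⟩, _⟩ h4
    have : (0 : ℝ) ≤ k y := Nat.cast_nonneg _
    linarith
  obtain ⟨a, j, ha, hlim, -, hj⟩ := hconv.tendsto_defect
  have heq : ∀ᶠ y in l, defect (p y) + k₀ = y := by
    filter_upwards [h1, hk₀] with y h1 h2
    rw [← h2, h1.1.2.2]
  have hx' : defect a + j + k₀ = x :=
    tendsto_nhds_unique ((hlim.add_const (k₀ : ℝ)).congr' heq) hlx
  have hr : r ≤ k₀ := by
    obtain ⟨y, hy, hy'⟩ := (h1.and hk₀).exists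
    exact hy' ▸ hy.1.2.1
  rcases hj with hj | hj
  · exact ⟨a, j + k₀, ha, by omega, by push_cast; rw [← hx', add_assoc]⟩
  · obtain ⟨y, ⟨h1, h2⟩, h3⟩ := ((hj.and heq).and (h1.mono fun y hy => hy.2)).exists
    exact absurd (by rw [← h2, h1, hx']) h3

theorem closure_shiftedDefects_zero_subset : closure (shiftedDefects 0) ⊆ shiftedDefects 0 := by
  intro x hx
  by_contra h
  refine h (shiftedDefects_antitone zero_le_one (mem_shiftedDefects_succ_of_mem_closure ?_))
  rwa [Set.sdiff_singleton_eq_self h]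

/-! ### Well-ordering -/

/-- A descending sequence in the closure gives disjoint open intervals around its odd terms; points
of `S` chosen in them descend as well. -/
theorem isWF_closure {S : Set ℝ} (hS : S.IsWF) : (closure S).IsWF := by
  rw [Set.isWF_iff_no_descending_seq] at *
  intro f hf hmem
  have hex : ∀ i : ℕ, ∃ d ∈ S, d ∈ Set.Ioo (f (2 * i + 2)) (f (2 * i)) := fun i => by
    obtain ⟨d, hd, hd'⟩ := mem_closure_iff.1 (hmem (2 * i + 1)) _ isOpen_Ioo
      (⟨hf (by omega), hf (by omega)⟩ : f (2 * i + 1) ∈ Set.Ioo (f (2 * i + 2)) (f (2 * i)))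
    exact ⟨d, hd', hd⟩
  choose d hd hd' using hex
  exact hS d (strictAnti_nat_of_succ_lt fun i => (hd' (i + 1)).2.trans (hd' i).1) hd

/-- A strictly decreasing sequence lies strictly above its limit, whereas defects converge from
below. -/
theorem isWF_stableDefects : stableDefects.IsWF := by
  rw [Set.isWF_iff_no_descending_seq]
  intro f hf hmem
  choose n hn hnf using hmem
  let l : Ultrafilter ℕ := Filter.hyperfilter ℕ
  have hconv : ConvergesUpToThreePow l n := by
    refine convergesUpToThreePow_of_defect_le (s := f 0) (.of_forall fun i => (hn i).1)
      (.of_forall fun i => ?_)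
    rw [hnf]
    exact hf.antitone (Nat.zero_le i)
  obtain ⟨p, k, -, hlim, hle, -⟩ := hconv.tendsto_defect
  obtain ⟨i, hi⟩ := hle.exists
  have hl : (l : Filter ℕ) ≤ Filter.atTop := Nat.hyperfilter_le_atTop
  have : defect p + k ≤ f (i + 1) := by
    refine le_of_tendsto hlim ?_
    filter_upwards [hl (Filter.eventually_ge_atTop (i + 1))] with j hj
    rw [hnf]
    exact hf.antitone hj
  rw [hnf] at hi
  exact absurd (hf (Nat.lt_succ_self i)) (by simp only [Nat.succ_eq_add_one]; linarith)

/-! ### Stable numbers and the family q·3^m + 1 -/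

theorem IsStable.one_lt {q : ℕ} (hq : IsStable q) : 1 < q := by
  refine lt_of_le_of_ne hq.1 ?_
  rintro rfl
  have := hq.2 1
  rw [mul_one, cpx_three_pow one_ne_zero, cpx_one] at this
  omega

theorem defect_le_defect_three_pow_mul {m : ℕ} (hm : 0 < m) (t : ℕ) :
    defect (3 ^ t * m) ≤ defect m := by
  have hm' : (m : ℝ) ≠ 0 := by exact_mod_cast hm.ne'
  have h : (cpx (3 ^ t * m) : ℝ) ≤ 3 * t + cpx m := by exact_mod_cast cpx_three_pow_mul_le t hm
  rw [defect, defect]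
  push_cast
  rw [Real.logb_mul (by positivity) hm', logb_three_pow]
  linarith

theorem exists_eq_three_pow_mul {x y p q : ℕ} (hq : 0 < q) (hxy : x ≤ y)
    (h : 3 ^ x * p ^ 3 = 3 ^ y * q ^ 3) : ∃ t, p = 3 ^ t * q := by
  obtain ⟨d, rfl⟩ := Nat.exists_eq_add_of_le hxy
  rw [pow_add, mul_assoc] at h
  have h := Nat.eq_of_mul_eq_mul_left (by positivity) h
  obtain ⟨r, rfl⟩ := (Nat.pow_dvd_pow_iff three_ne_zero).1 (Dvd.intro_left _ h.symm)
  rw [mul_pow, mul_comm] at h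
  have h := Nat.eq_of_mul_eq_mul_right (by positivity) h
  obtain ⟨t, -, rfl⟩ := (Nat.dvd_prime_pow Nat.prime_three).1
    ((Dvd.intro _ (by rw [← h]; ring : r * r ^ 2 = 3 ^ d)))
  exact ⟨t, mul_comm _ _⟩

/-- A stable defect does not exceed the defect of any number by a positive integer. -/
theorem IsStable.shift_eq_zero {q p k : ℕ} (hq : IsStable q) (hp : 0 < p)
    (h : defect q = defect p + k) : k = 0 := by
  have hq' : (0 : ℝ) < q := by exact_mod_cast hq.1
  have hp' : (0 : ℝ) < p := by exact_mod_cast hp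
  have hlog : (cpx q : ℝ) + Real.logb 3 ((p : ℝ) ^ 3) =
      cpx p + k + Real.logb 3 ((q : ℝ) ^ 3) := by
    rw [defect, defect, three_mul_logb_natCast, three_mul_logb_natCast] at h
    linarith
  have hnat : 3 ^ cpx q * p ^ 3 = 3 ^ (cpx p + k) * q ^ 3 := by
    have h1 : Real.logb 3 ((3 : ℝ) ^ cpx q * (p : ℝ) ^ 3) =
        Real.logb 3 ((3 : ℝ) ^ (cpx p + k) * (q : ℝ) ^ 3) := by
      rw [Real.logb_mul (by positivity) (by positivity), Real.logb_mul (by positivity)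
        (by positivity), logb_three_pow, logb_three_pow, hlog]
      push_cast
      ring
    have h2 := Real.logb_injOn_pos (b := 3) (by norm_num) (Set.mem_Ioi.2 (by positivity))
      (Set.mem_Ioi.2 (by positivity)) h1
    exact_mod_cast h2
  have hpow : (∃ t, q = 3 ^ t * p) ∨ ∃ t, p = 3 ^ t * q := by
    rcases le_total (cpx q) (cpx p + k) with hle | hle
    · exact Or.inr (exists_eq_three_pow_mul hq.1 hle hnat)
    · exact Or.inl (exists_eq_three_pow_mul hp hle hnat.symm)
  have hk : (0 : ℝ) ≤ k := Nat.cast_nonneg k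
  have : (k : ℝ) ≤ 0 := by
    -- Either way δ(q) ≤ δ(p): multiplying by powers of three never raises a defect, and keeps that
    -- of the stable q.
    rcases hpow with ⟨t, rfl⟩ | ⟨t, rfl⟩
    · have := defect_le_defect_three_pow_mul hp t
      linarith
    · have := defect_three_pow_mul hq.1 (hq.2 t)
      linarith
  exact_mod_cast le_antisymm this hk

/-- For stable `q`, the complexities of `3 ^ s * (q * 3 ^ m + 1)` are eventually not smaller than
expected. -/
theorem IsStable.not_eventually_cpx_le {q : ℕ} (hq : IsStable q) {l : Ultrafilter ℕ}
    (hl : (l : Filter ℕ) ≤ Filter.atTop) (s : ℕ → ℕ) :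
    ¬ ∀ᶠ m in l, cpx (3 ^ s m * (q * 3 ^ m + 1)) ≤ cpx q + 3 * m + 3 * s m := by
  intro h
  have hq' : (0 : ℝ) < q := by exact_mod_cast hq.1
  -- The defect is split into an integer `z` and a term `w` that decreases to 3 log₃ q without
  -- reaching it.
  let z : ℕ → ℤ := fun m => cpx (3 ^ s m * (q * 3 ^ m + 1)) - 3 * m - 3 * s m
  let w : ℕ → ℝ := fun m => 3 * Real.logb 3 (q + 1 / (3 : ℝ) ^ m)
  have hdef : ∀ m, defect (3 ^ s m * (q * 3 ^ m + 1)) = z m - w m := by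
    intro m
    have : ((q : ℝ) * 3 ^ m + 1) = 3 ^ m * (q + 1 / 3 ^ m) := by field_simp
    simp only [defect, z, w]
    push_cast
    rw [this, Real.logb_mul (by positivity) (by positivity),
      Real.logb_mul (by positivity) (by positivity), logb_three_pow, logb_three_pow]
    ring
  have hw : ∀ m, 3 * Real.logb 3 q < w m := fun m => by
    have := Real.logb_lt_logb (b := 3) (by norm_num) hq'
      (lt_add_of_pos_right (q : ℝ) (by positivity : (0 : ℝ) < 1 / 3 ^ m))
    simp only [w]
    linarith
  have hwlim : Filter.Tendsto w l (nhds (3 * Real.logb 3 q)) := by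
    have h1 : Filter.Tendsto (fun m : ℕ => (3 : ℝ) ^ m) l Filter.atTop :=
      (tendsto_pow_atTop_atTop_of_one_lt (by norm_num)).mono_left hl
    have h2 := ((h1.const_div_atTop 1).const_add (q : ℝ)).logb (b := 3) (by rw [add_zero]; positivity)
    simpa [w] using h2.const_mul 3
  have hz : ∀ᶠ m in l, (z m : ℝ) ≤ cpx q := h.mono fun m hm => by
    have : z m ≤ cpx q := by
      simp only [z]
      omega
    exact_mod_cast this
  have hconv : ConvergesUpToThreePow l (fun m => 3 ^ s m * (q * 3 ^ m + 1)) := by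
    refine convergesUpToThreePow_of_defect_le (s := defect q)
      (.of_forall fun m => by positivity) (hz.mono fun m hm => ?_)
    have := hw m
    rw [hdef, defect]
    linarith
  obtain ⟨p, k, hp, hlim, -, hk⟩ := hconv.tendsto_defect
  have hzlim : Filter.Tendsto (fun m => (z m : ℝ)) l
      (nhds (defect p + k + 3 * Real.logb 3 q)) :=
    (hlim.add hwlim).congr fun m => by rw [hdef]; ring
  -- A limit of integers is an integer; it is at most ‖q‖, so δ(q) is δ(p) plus a natural number,
  -- which stability forces to be 0.
  obtain ⟨z₀, hz₀⟩ : defect p + k + 3 * Real.logb 3 q ∈ Set.range ((↑) : ℤ → ℝ) :=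
    Int.isClosedEmbedding_coe_real.isClosed_range.mem_of_tendsto hzlim
      (.of_forall fun m => ⟨z m, rfl⟩)
  have hle : (z₀ : ℝ) ≤ cpx q := hz₀ ▸ le_of_tendsto hzlim hz
  obtain ⟨j, hj⟩ := Int.le.dest (by exact_mod_cast hle : z₀ ≤ cpx q)
  have hj' : (z₀ : ℝ) + j = cpx q := by exact_mod_cast hj
  have hkj : k + j = 0 := by
    refine hq.shift_eq_zero hp ?_
    rw [defect]
    push_cast
    linarith
  rcases hk with hk | hk
  · omega
  -- With k = 0 the defects are eventually constant. As `w` exceeds its limit, the integer `z`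
  -- exceeds z₀, hence by at least 1, and cannot tend to z₀.
  have hge : ∀ᶠ m in l, ((z₀ + 1 : ℤ) : ℝ) ≤ z m := hk.mono fun m hm => by
    have h1 := hw m
    rw [hdef] at hm
    have : (z₀ : ℝ) < z m := by linarith
    exact_mod_cast Int.add_one_le_iff.2 (by exact_mod_cast this)
  have := ge_of_tendsto hzlim hge
  rw [← hz₀] at this
  push_cast at this
  linarith

/-- Both claims follow once ‖3^s(q·3^m + 1)‖ > ‖q‖ + 3m + 3s for all s, since the opposite bound is
immediate. Testing on ultrafilters lets a failing s be chosen for each m. -/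
theorem IsStable.eventually_isStable {q : ℕ} (hq : IsStable q) :
    ∀ᶠ m in Filter.atTop, IsStable (q * 3 ^ m + 1) ∧ cpx (q * 3 ^ m + 1) = cpx q + 3 * m + 1 := by
  refine Filter.mem_iff_ultrafilter.2 fun l hl => ?_
  rcases l.em (fun m => ∃ s, cpx (3 ^ s * (q * 3 ^ m + 1)) ≤ cpx q + 3 * m + 3 * s) with h | h
  · have hex : ∀ m, ∃ s, (∃ s, cpx (3 ^ s * (q * 3 ^ m + 1)) ≤ cpx q + 3 * m + 3 * s) →
        cpx (3 ^ s * (q * 3 ^ m + 1)) ≤ cpx q + 3 * m + 3 * s := fun m => by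
      by_cases hm : ∃ s, cpx (3 ^ s * (q * 3 ^ m + 1)) ≤ cpx q + 3 * m + 3 * s
      · exact ⟨hm.choose, fun _ => hm.choose_spec⟩
      · exact ⟨0, fun h => absurd h hm⟩
    choose s hs using hex
    exact absurd (h.mono fun m hm => hs m hm) (hq.not_eventually_cpx_le hl s)
  · filter_upwards [h] with m hm
    simp only [not_exists, not_le] at hm
    have hpos : 0 < q * 3 ^ m := Nat.mul_pos hq.1 (by positivity)
    have h1 := cpx_add_le hpos one_pos
    rw [cpx_one, mul_comm, hq.2 m, mul_comm] at h1
    have h0 := hm 0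
    rw [pow_zero, one_mul] at h0
    refine ⟨⟨Nat.succ_pos _, fun s => ?_⟩, by omega⟩
    have h2 := cpx_three_pow_mul_le s (Nat.succ_pos (q * 3 ^ m))
    have h3 := hm s
    rw [Nat.succ_eq_add_one] at h2
    omega

/-- A stable defect, shifted by `k + 1`, is the limit from below of stable defects in the
appropriate class, shifted by `k`. -/
theorem IsStable.exists_shifted_defect_mem_Ioo {q : ℕ} (hq : IsStable q) {y : ℝ} (k : ℕ)
    (hy : y < defect q + (k + 1 : ℕ)) :
    ∃ q', IsStable q' ∧ ((cpx q' + k : ℕ) : ZMod 3) = ((cpx q + (k + 1) : ℕ) : ZMod 3) ∧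
      defect q' + k ∈ Set.Ioo y (defect q + (k + 1 : ℕ)) := by
  have hq' : (0 : ℝ) < q := by exact_mod_cast hq.1
  have hlim : Filter.Tendsto
      (fun m : ℕ => defect q + (k + 1 : ℕ) - 3 * Real.logb 3 (1 + 1 / (q * (3 : ℝ) ^ m))) Filter.atTop
      (nhds (defect q + (k + 1 : ℕ))) := by
    have h1 : Filter.Tendsto (fun m : ℕ => (q : ℝ) * (3 : ℝ) ^ m) Filter.atTop Filter.atTop :=
      (tendsto_pow_atTop_atTop_of_one_lt (by norm_num)).const_mul_atTop hq'
    have h2 := (((h1.const_div_atTop 1).const_add (1 : ℝ)).logb (b := 3)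
      (by norm_num)).const_mul 3 |>.const_sub (defect q + 1 + k)
    rwa [add_zero, Real.logb_one, mul_zero, sub_zero,
      show defect q + 1 + k = defect q + (k + 1 : ℕ) by push_cast; ring] at h2
  -- The required q' is q·3^m + 1 with m large.
  obtain ⟨m, ⟨hs, hc⟩, hm⟩ := (hq.eventually_isStable.and (hlim.eventually_const_lt hy)).exists
  have hpos : 0 < q * 3 ^ m := Nat.mul_pos hq.1 (by positivity)
  have hc3 : cpx (q * 3 ^ m) = 3 * m + cpx q := by rw [mul_comm, hq.2 m]
  have hd : defect (q * 3 ^ m + 1) + k =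
      defect q + (k + 1 : ℕ) - 3 * Real.logb 3 (1 + 1 / (q * (3 : ℝ) ^ m)) := by
    rw [defect_add hpos (by rw [cpx_one]; omega), cpx_one, mul_comm q,
      defect_three_pow_mul hq.1 (hq.2 m)]
    push_cast
    rw [mul_comm (q : ℝ)]
    ring
  refine ⟨_, hs, ?_, hd ▸ hm, ?_⟩
  · rw [hc]
    push_cast
    rw [show (3 : ZMod 3) = 0 from rfl]
    ring
  · have : 0 < Real.logb 3 (1 + 1 / (q * (3 : ℝ) ^ m)) :=
      Real.logb_pos (by norm_num) (lt_add_of_pos_right _ (by positivity))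
    rw [hd]
    push_cast
    linarith

/-- Each further unit of shift is one more passage to a limit, and the closure is already closed. -/
theorem IsStable.defect_add_natCast_mem_closure (k : ℕ) : ∀ {q : ℕ}, IsStable q →
    defect q + k ∈ closure (classStableDefects ((cpx q + k : ℕ) : ZMod 3)) := by
  induction k with
  | zero =>
    intro q hq
    refine subset_closure ⟨⟨q, hq.one_lt, by simp, by simp⟩, q, hq, by simp⟩
  | succ k ih =>
    intro q hq
    rw [← closure_closure]
    refine mem_closure_iff_nhds.2 fun t ht => ?_
    obtain ⟨y, hy, hyt⟩ := exists_Ioc_subset_of_mem_nhds ht ⟨_, sub_one_lt _⟩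
    obtain ⟨q', hq', hc, h1, h2⟩ := hq.exists_shifted_defect_mem_Ioo k hy
    exact ⟨_, hyt ⟨h1, h2.le⟩, hc ▸ ih hq'⟩

/-! ### Divisibility by powers of ω and Cantor normal form -/

/-- Write α = ω^k·c + r. A nonzero r would leave no multiple of ω^k strictly between ω^k·c and α,
and a predecessor of c would leave none after ω^k·c'. So r = 0 and c is zero or a limit, that is, a
multiple of ω. -/
theorem omega0_opow_succ_dvd_of_forall_lt {α : Ordinal.{0}} {k : ℕ}
    (h : ∀ γ < α, ∃ μ, γ < μ ∧ μ < α ∧ Ordinal.omega0 ^ (k : Ordinal) ∣ μ) :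
    Ordinal.omega0 ^ ((k + 1 : ℕ) : Ordinal) ∣ α := by
  have hpos : (Ordinal.omega0 ^ (k : Ordinal)) ≠ 0 := (Ordinal.opow_pos _ Ordinal.omega0_pos).ne'
  have hdm := Ordinal.div_add_mod α (Ordinal.omega0 ^ (k : Ordinal))
  have hmod := Ordinal.mod_lt α hpos
  generalize α / Ordinal.omega0 ^ (k : Ordinal) = c at *
  generalize α % Ordinal.omega0 ^ (k : Ordinal) = r at *
  generalize hP : Ordinal.omega0 ^ (k : Ordinal) = P at *
  have hr : r = 0 := by
    by_contra hr
    obtain ⟨_, h1, h2, d, rfl⟩ := h (P * c) (hdm ▸ lt_add_of_pos_right _ (pos_iff_ne_zero.2 hr))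
    have h3 : c < d := lt_of_mul_lt_mul_left' h1
    have h4 : P * (Order.succ c) ≤ P * d := mul_le_mul_right (Order.succ_le_of_lt h3) P
    rw [Ordinal.mul_succ] at h4
    rw [← hdm] at h2
    exact absurd (h4.trans_lt h2) (not_lt.2 (add_le_add_right hmod.le _))
  subst hr
  rw [add_zero] at hdm
  subst hdm
  rw [Nat.cast_succ, ← Order.succ_eq_add_one, Ordinal.opow_succ, hP]
  refine mul_dvd_mul_left _ (Ordinal.isSuccPrelimit_iff_omega0_dvd.1 ?_)
  refine Order.isSuccPrelimit_of_succ_ne fun c' hc' => ?_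
  subst hc'
  obtain ⟨_, h1, h2, d, rfl⟩ := h (P * c')
    (mul_lt_mul_of_pos_left (Order.lt_succ c') (pos_iff_ne_zero.2 hpos))
  have h3 : c' < d := lt_of_mul_lt_mul_left' h1
  have h4 : d < Order.succ c' := lt_of_mul_lt_mul_left' h2
  exact absurd (Order.succ_le_of_lt h3) (not_le.2 h4)

theorem exists_omega0_opow_dvd_of_lt {α γ : Ordinal.{0}} {k : ℕ}
    (h : Ordinal.omega0 ^ ((k + 1 : ℕ) : Ordinal) ∣ α) (hγ : γ < α) :
    ∃ μ, γ < μ ∧ μ < α ∧ Ordinal.omega0 ^ (k : Ordinal) ∣ μ := by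
  obtain ⟨d, rfl⟩ := h
  have hpos : (Ordinal.omega0 ^ (k : Ordinal)) ≠ 0 := (Ordinal.opow_pos _ Ordinal.omega0_pos).ne'
  rw [Nat.cast_succ, ← Order.succ_eq_add_one, Ordinal.opow_succ, mul_assoc] at *
  -- The witness is the next multiple of ω^k after γ; it stays below α because ω·d has no
  -- predecessor.
  refine ⟨_, Ordinal.lt_mul_succ_div γ hpos, mul_lt_mul_of_pos_left ?_ (pos_iff_ne_zero.2 hpos),
    dvd_mul_right _ _⟩
  exact (Ordinal.isSuccPrelimit_iff_omega0_dvd.2 (dvd_mul_right _ d)).succ_lt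
    ((Ordinal.lt_mul_iff_div_lt hpos).1 hγ)

/-- The last exponent is the largest e with ω^e ∣ α. The bound by the leading exponent is carried
along so that ω^e divides the leading term, letting divisibility pass between α and its remainder.
-/
theorem lastCNFExponent_spec (α : Ordinal.{0}) (hα : α ≠ 0) :
    lastCNFExponent α ≤ Ordinal.log Ordinal.omega0 α ∧
    Ordinal.omega0 ^ lastCNFExponent α ∣ α ∧
      ∀ e, Ordinal.omega0 ^ e ∣ α → e ≤ lastCNFExponent α := by
  induction α using Ordinal.CNF.rec Ordinal.omega0 with
  | H0 => exact absurd rfl hα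
  | H α h0 ih =>
    have hcnf := Ordinal.CNF.ne_zero (b := Ordinal.omega0) h0
    have hdm := Ordinal.div_add_mod α (Ordinal.omega0 ^ Ordinal.log Ordinal.omega0 α)
    have hle : ∀ e, Ordinal.omega0 ^ e ∣ α → e ≤ Ordinal.log Ordinal.omega0 α := fun e he =>
      (Ordinal.opow_le_iff_le_log Ordinal.one_lt_omega0 h0).1 (Ordinal.le_of_dvd h0 he)
    by_cases hr : α % Ordinal.omega0 ^ Ordinal.log Ordinal.omega0 α = 0
    · have hlast : lastCNFExponent α = Ordinal.log Ordinal.omega0 α := by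
        rw [lastCNFExponent, hcnf, hr]
        simp
      rw [hlast]
      exact ⟨le_rfl, Ordinal.dvd_of_mod_eq_zero hr, hle⟩
    · have hlast : lastCNFExponent α =
          lastCNFExponent (α % Ordinal.omega0 ^ Ordinal.log Ordinal.omega0 α) := by
        have hne := Ordinal.CNF.ne_zero (b := Ordinal.omega0) hr
        rw [lastCNFExponent, lastCNFExponent, hcnf, hne]
        simp
      obtain ⟨h1, h2, h3⟩ := ih hr
      rw [← hlast] at h1 h2 h3
      have hlog : Ordinal.log Ordinal.omega0
          (α % Ordinal.omega0 ^ Ordinal.log Ordinal.omega0 α) ≤ Ordinal.log Ordinal.omega0 α :=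
        Ordinal.log_mono_right _ (Ordinal.mod_le _ _)
      have hdvd : ∀ e ≤ Ordinal.log Ordinal.omega0 α, Ordinal.omega0 ^ e ∣
          Ordinal.omega0 ^ Ordinal.log Ordinal.omega0 α *
            (α / Ordinal.omega0 ^ Ordinal.log Ordinal.omega0 α) := fun e he =>
        (Ordinal.opow_dvd_opow _ he).mul_right _
      refine ⟨h1.trans hlog, ?_, fun e he => h3 e ?_⟩
      · have := (Ordinal.dvd_add_iff (hdvd _ (h1.trans hlog))).2 h2
        rwa [hdm] at this
      · rw [← hdm] at he
        exact (Ordinal.dvd_add_iff (hdvd e (hle e (hdm ▸ he)))).1 he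

theorem lastCNFExponent_eq_natCast {α : Ordinal.{0}} (hα : α ≠ 0) {k : ℕ}
    (h : Ordinal.omega0 ^ (k : Ordinal) ∣ α)
    (h' : ¬ Ordinal.omega0 ^ ((k + 1 : ℕ) : Ordinal) ∣ α) :
    lastCNFExponent α = k := by
  obtain ⟨-, h1, h2⟩ := lastCNFExponent_spec α hα
  refine le_antisymm (not_lt.1 fun hlt => h' ?_) (h2 _ h)
  refine (Ordinal.opow_dvd_opow _ ?_).trans h1
  rw [Nat.cast_succ, ← Order.succ_eq_add_one]
  exact Order.succ_le_of_lt hlt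

/-! ### Positions in well-ordered sets of reals -/

theorem IsElemZeroIndexed.exists_of_isWF {S : Set ℝ} (hS : S.IsWF) {x : ℝ} (hx : x ∈ S) :
    ∃ β, IsElemZeroIndexed S β x := by
  have : IsWellOrder {s : ℝ // s ∈ S ∧ s < x} (· < ·) :=
    { wf := hS.mono (Set.sep_subset S (· < x)) }
  exact ⟨_, hx, ⟨OrderIso.ofRelIsoLT
    (Ordinal.enum (fun a b : {s : ℝ // s ∈ S ∧ s < x} => a < b))⟩⟩

theorem isElemZeroIndexed_orderIso {S : Set ℝ} {β : Ordinal.{0}} {x : ℝ}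
    (e : Set.Iio β ≃o {s : ℝ // s ∈ S ∧ s < x}) (γ : Set.Iio β) :
    IsElemZeroIndexed S γ (e γ) := by
  refine ⟨(e γ).2.1, ⟨?_⟩⟩
  refine
    { toFun := fun d => ⟨e ⟨d, Set.mem_Iio.2 (lt_trans (Set.mem_Iio.1 d.2) γ.2)⟩, (e _).2.1, e.lt_iff_lt.2 d.2⟩
      invFun := fun s => ⟨e.symm ⟨s, s.2.1, s.2.2.trans (e γ).2.2⟩,
        e.symm_apply_lt.2 (show (⟨s, _⟩ : {s : ℝ // s ∈ S ∧ s < x}) < e γ from s.2.2)⟩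
      left_inv := fun d => ?_
      right_inv := fun s => ?_
      map_rel_iff' := ?_ }
  · simp
  · simp
  · intro a b
    exact e.le_iff_le

/-- The positions of the elements below an element of known position. -/
theorem IsElemOneIndexed.exists_index {S : Set ℝ} {α : Ordinal.{0}} {x : ℝ}
    (h : IsElemOneIndexed S α x) :
    ∃ F : {s : ℝ // s ∈ S ∧ s < x} → Ordinal.{0}, StrictMono F ∧
      (∀ s, 0 < F s ∧ F s < α ∧ IsElemOneIndexed S (F s) s) ∧
      ∀ γ, 0 < γ → γ < α → ∃ s, F s = γ := by
  obtain ⟨β, rfl, hx, ⟨e⟩⟩ := h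
  refine ⟨fun s => 1 + (e.symm s).1, fun s t hst => ?_, fun s => ⟨?_, ?_, ?_⟩,
    fun γ h0 hγ => ?_⟩
  · have h : (e.symm s).1 < (e.symm t).1 := e.symm.lt_iff_lt.2 hst
    exact add_lt_add_right h 1
  · exact lt_of_lt_of_le zero_lt_one le_self_add
  · exact add_lt_add_right (e.symm s).2 1
  · refine ⟨_, rfl, ?_⟩
    simpa using isElemZeroIndexed_orderIso e (e.symm s)
  · have h1 : 1 + (γ - 1) = γ := Ordinal.add_sub_cancel_of_le (Order.one_le_iff_pos.2 h0)
    have h2 : γ - 1 < β := by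
      rw [← h1] at hγ
      exact lt_of_add_lt_add_left hγ
    exact ⟨e ⟨γ - 1, h2⟩, by simpa using h1⟩

theorem IsElemOneIndexed.mem {S : Set ℝ} {α : Ordinal.{0}} {x : ℝ}
    (h : IsElemOneIndexed S α x) : x ∈ S := by
  obtain ⟨_, _, hx, _⟩ := h
  exact hx

theorem IsElemOneIndexed.ne_zero {S : Set ℝ} {α : Ordinal.{0}} {x : ℝ}
    (h : IsElemOneIndexed S α x) : α ≠ 0 := by
  obtain ⟨_, rfl, _⟩ := h
  exact (lt_of_lt_of_le zero_lt_one le_self_add).ne'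

theorem IsElemOneIndexed.exists_of_isWF {S : Set ℝ} (hS : S.IsWF) {x : ℝ} (hx : x ∈ S) :
    ∃ α, IsElemOneIndexed S α x := by
  obtain ⟨β, hβ⟩ := IsElemZeroIndexed.exists_of_isWF hS hx
  exact ⟨1 + β, β, rfl, hβ⟩

/-! ### The last exponent of the position -/

/-- The position of a stable defect shifted by `k` is divisible by `ω ^ k`. -/
theorem IsElemOneIndexed.omega0_opow_dvd {S : Set ℝ} (hS : IsClosed S) {u : ZMod 3}
    (hu : classStableDefects u ⊆ S) (k : ℕ) :
    ∀ {q : ℕ} {α : Ordinal.{0}}, IsStable q → ((cpx q + k : ℕ) : ZMod 3) = u →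
      IsElemOneIndexed S α (defect q + k) → Ordinal.omega0 ^ (k : Ordinal) ∣ α := by
  induction k with
  | zero => simp
  | succ k ih =>
    intro q α hq hqu hα
    obtain ⟨F, hF, hFα, hFsurj⟩ := hα.exists_index
    have hmem : ∀ y < defect q + (k + 1 : ℕ), ∃ s : {s : ℝ // s ∈ S ∧ s < defect q + (k + 1 : ℕ)},
        y < s ∧ Ordinal.omega0 ^ (k : Ordinal) ∣ F s := by
      intro y hy
      obtain ⟨q', hq', hc, h1, h2⟩ := hq.exists_shifted_defect_mem_Ioo k hy
      have h3 : defect q' + k ∈ S :=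
        closure_minimal hu hS (hqu ▸ hc ▸ hq'.defect_add_natCast_mem_closure k)
      exact ⟨⟨_, h3, h2⟩, h1, ih hq' (hc.trans hqu) (hFα ⟨_, h3, h2⟩).2.2⟩
    refine omega0_opow_succ_dvd_of_forall_lt fun γ hγ => ?_
    -- Index 0 names no element, so there any smaller element from `hmem` will do.
    rcases eq_zero_or_pos γ with rfl | h0
    · obtain ⟨s, -, hs⟩ := hmem _ (sub_one_lt _)
      exact ⟨F s, (hFα s).1, (hFα s).2.1, hs⟩
    · obtain ⟨t, rfl⟩ := hFsurj γ h0 hγ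
      obtain ⟨s, hts, hs⟩ := hmem t t.2.2
      exact ⟨F s, hF hts, (hFα s).2.1, hs⟩

/-- An element whose position is divisible by `ω ^ r` is a defect shifted by at least `r`. -/
theorem IsElemOneIndexed.mem_shiftedDefects {S : Set ℝ} (hS : IsClosed S)
    (hsub : S ⊆ shiftedDefects 0) (r : ℕ) : ∀ {α : Ordinal.{0}} {x : ℝ},
      IsElemOneIndexed S α x → Ordinal.omega0 ^ (r : Ordinal) ∣ α → x ∈ shiftedDefects r := by
  induction r with
  | zero => exact fun h _ => hsub h.mem
  | succ r ih =>
    intro α x hα hdvd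
    obtain ⟨F, hF, hFα, hFsurj⟩ := hα.exists_index
    have hnext : ∀ γ < α, ∃ s, γ < F s ∧ (s : ℝ) ∈ shiftedDefects r := fun γ hγ => by
      obtain ⟨μ, h1, h2, h3⟩ := exists_omega0_opow_dvd_of_lt hdvd hγ
      obtain ⟨s, rfl⟩ := hFsurj μ (zero_le.trans_lt h1) h2
      exact ⟨s, h1, ih (hFα s).2.2 h3⟩
    let T : Set ℝ := {s | s ∈ S ∧ s < x}
    have hne : T.Nonempty := by
      obtain ⟨s, -⟩ := hnext 0 (pos_iff_ne_zero.2 hα.ne_zero)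
      exact ⟨s, s.2⟩
    have hbdd : BddAbove T := ⟨x, fun s hs => hs.2.le⟩
    -- Were the supremum smaller, it would be an element of the closed set `S` with index below α,
    -- and `hnext` would give a later element still below `x`.
    have hsup : sSup T = x := by
      refine le_antisymm (csSup_le hne fun s hs => hs.2.le) (not_lt.1 fun hlt => ?_)
      have hmem : sSup T ∈ S :=
        closure_minimal (fun s hs => hs.1) hS (csSup_mem_closure hne hbdd)
      obtain ⟨s, hs, -⟩ := hnext _ (hFα ⟨sSup T, hmem, hlt⟩).2.1
      exact absurd (le_csSup hbdd s.2) (not_le.2 (hF.lt_iff_lt.1 hs))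
    refine mem_shiftedDefects_succ_of_mem_closure (Metric.mem_closure_iff.2 fun ε hε => ?_)
    obtain ⟨s, hs, hlt⟩ := exists_lt_of_lt_csSup hne (by linarith : x - ε < sSup T)
    obtain ⟨y, hy, hyr⟩ := hnext _ (hFα ⟨s, hs⟩).2.1
    have hy : s < y := hF.lt_iff_lt.1 hy
    have hyx := y.2.2
    refine ⟨y, ⟨hyr, hyx.ne⟩, ?_⟩
    rw [Real.dist_eq, abs_of_pos (by linarith)]
    linarith

/-- If ω^(k+1) divided the index, δ(q) + k would equal δ(p) + j with j > k, so the stable δ(q) would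
exceed δ(p) by a positive integer. -/
theorem IsElemOneIndexed.lastCNFExponent_eq {S : Set ℝ} (hS : IsClosed S)
    (hsub : S ⊆ shiftedDefects 0) {q k : ℕ} (hq : IsStable q)
    (hu : classStableDefects ((cpx q + k : ℕ) : ZMod 3) ⊆ S) {α : Ordinal.{0}}
    (hα : IsElemOneIndexed S α (defect q + k)) : lastCNFExponent α = (k : Ordinal.{0}) := by
  refine lastCNFExponent_eq_natCast hα.ne_zero (hα.omega0_opow_dvd hS hu k hq rfl) fun hdvd => ?_
  obtain ⟨p, j, hp, hj, h⟩ := hα.mem_shiftedDefects hS hsub (k + 1) hdvd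
  have h0 := hq.shift_eq_zero hp (k := j - k) (by
    rw [Nat.cast_sub (by omega)]
    linarith)
  omega

theorem mainTheorem9 (q k : ℕ) (hq : IsStable q) (η : ℝ) (hη : η = defect q + (k : ℝ)) :
    (closure stableDefects).IsWF ∧
    (closure (classStableDefects ((cpx q + k : ℕ) : ZMod 3))).IsWF ∧
    η ∈ closure (classStableDefects ((cpx q + k : ℕ) : ZMod 3)) ∧
    (∃ α : Ordinal.{0}, IsElemOneIndexed (closure stableDefects) α η) ∧
    (∀ α : Ordinal.{0}, IsElemOneIndexed (closure stableDefects) α η →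
      lastCNFExponent α = (k : Ordinal.{0})) ∧
    (∃ β : Ordinal.{0},
      IsElemOneIndexed (closure (classStableDefects ((cpx q + k : ℕ) : ZMod 3))) β η) ∧
    (∀ β : Ordinal.{0},
      IsElemOneIndexed (closure (classStableDefects ((cpx q + k : ℕ) : ZMod 3))) β η →
        lastCNFExponent β = (k : Ordinal.{0})) := by
  subst hη
  have hsub : classStableDefects ((cpx q + k : ℕ) : ZMod 3) ⊆ stableDefects :=
    Set.inter_subset_right
  have hwf := isWF_closure isWF_stableDefects
  have hwf' := isWF_closure (isWF_stableDefects.mono hsub)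
  have hmem := hq.defect_add_natCast_mem_closure k
  have h0 : closure stableDefects ⊆ shiftedDefects 0 :=
    (closure_mono stableDefects_subset_shiftedDefects).trans closure_shiftedDefects_zero_subset
  exact ⟨hwf, hwf', hmem, IsElemOneIndexed.exists_of_isWF hwf (closure_mono hsub hmem),
    fun α hα => hα.lastCNFExponent_eq isClosed_closure h0 hq (hsub.trans subset_closure),
    IsElemOneIndexed.exists_of_isWF hwf' hmem,
    fun β hβ => hβ.lastCNFExponent_eq isClosed_closure ((closure_mono hsub).trans h0) hq
      subset_closure⟩
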